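/- For an even integer $n$ let $T=\{x\in\{0,1\}^n : |x|=n/2\}$ be the Boolean half-slice, where $|x|$ is the Hamming weight, and identify $\{0,1\}^n$ with $\mathbb F_2^n$, so that sums and the dot product $u\cdot x=\sum_i u_ix_i$ are taken modulo $2$. For $k\ge 3$, the $k$-query BLR test on $T$ picks $(x_1,\dots,x_{k-1})$ uniformly among the $(k-1)$-tuples such that $x_1,\dots,x_{k-1}$ and $x_1+\cdots+x_{k-1}$ all lie in $T$, and a function $f:T\to\{0,1\}$ passes if $f(x_1+\cdots+x_{k-1})=f(x_1)+\cdots+f(x_{k-1})$ modulo $2$. (a) (Three-query test.) There is a sequence $\eta(n)\to 0$ such that the following holds for every multiple $n$ of $4$. If $f:T\to\{0,1\}$ passes the $3$-query BLR test with probability exactly $\frac{1+\delta}{2}$, then there is $u\in\{0,1\}^n$ with $$\Pr_{x\sim T}\bigl[f(x)=x\cdot u\bigr]\ \ge\ \frac{1+\delta}{2}-\eta(n).$$ (b) (General $k$.) For every integer $k\ge 3$ there is a sequence $\eta_k(n)\to 0$ as $n\to\infty$ such that the following holds for every even $n$ for which at least one of $k$ and $n/2$ is even. If $f:T\to\{0,1\}$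 passes the $k$-query BLR test with probability exactly $\frac{1+\delta}{2}$ for some $\delta>0$, then there are $u\in\{0,1\}^n$ and $b\in\{0,1\}$ with $$\Pr_{x\sim T}\bigl[f(x)=u\cdot x+b\bigr]\ \ge\ \frac{1+\delta^{1/(k-2)}}{2}-\eta_k(n).$$ Here $x\sim T$ is uniform in $T$, and $\eta$, $\eta_k$ do not depend on $f$ or $\delta$. -/

import Mathlib

open Filter Topology

noncomputable section

/-- The half-slice `T`: the vectors of `{0,1}^n` (as `𝔽₂^n`) of Hamming weight `n / 2`.
It is only used for even `n`. -/
abbrev HalfSlice (n : ℕ) : Type :=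
  {x : Fin n → ZMod 2 // hammingNorm x = n / 2}

/-- The probability of the event `p` for a uniformly random element of the finite type `Ω`. -/
def uniformProb {Ω : Type} (p : Ω → Prop) : ℝ :=
  (Nat.card {ω : Ω // p ω} : ℝ) / (Nat.card Ω : ℝ)

/-- The sample space of the `k`-query BLR test on the half-slice: the tuples
`(x₁, …, x_{k-1})` such that `x₁, …, x_{k-1}` and `x₁ + ⋯ + x_{k-1}` all lie in `T`.
For `k = 3` these are the pairs `(x, y)` with `x, y, x + y ∈ T`. -/
abbrev BLRSample (k n : ℕ) : Type :=
  {x : Fin (k - 1) → HalfSlice n // hammingNorm (∑ i, (x i).1) = n / 2}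

/-- The check made by the `k`-query BLR test:
`f (x₁ + ⋯ + x_{k-1}) = f x₁ + ⋯ + f x_{k-1}` in `𝔽₂`. -/
def BLRAccepts {k n : ℕ} (f : HalfSlice n → ZMod 2) (x : BLRSample k n) : Prop :=
  f ⟨∑ i, (x.1 i).1, x.2⟩ = ∑ i, f (x.1 i)

/-- The probability that `f` passes the `k`-query BLR test on the half-slice. -/
def blrPassProb (k : ℕ) {n : ℕ} (f : HalfSlice n → ZMod 2) : ℝ :=
  uniformProb (fun x : BLRSample k n => BLRAccepts f x)

/-- The fraction of the points `x` of the half-slice at which `f x = u · x + b`. -/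
def affineAgreement {n : ℕ} (f : HalfSlice n → ZMod 2) (u : Fin n → ZMod 2) (b : ZMod 2) : ℝ :=
  uniformProb (fun x : HalfSlice n => f x = u ⬝ᵥ x.1 + b)

/-- The fraction of the points `x` of the half-slice at which `f x = x · u`. -/
def linearAgreement {n : ℕ} (f : HalfSlice n → ZMod 2) (u : Fin n → ZMod 2) : ℝ :=
  uniformProb (fun x : HalfSlice n => f x = x.1 ⬝ᵥ u)

end

/-! Write `F = (-1)^f` and let `sliceCorr f u` be the mean over `T` of `F` times the Walsh character
of `u`. Fourier inversion on the cube turns the test into a ratio of power sums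
(`blrPassProb_mul_sum`): `2P - 1`, with `P` the pass probability, equals `∑ sliceCorr f u ^ k`
divided by the same sum for `f = 0`.

The denominator is at least `2 - o(1)`: `u = 0` and `u = 1` each contribute 1, the latter by the
parity hypothesis, and all other values are at most `1/(n-1)` in size. The numerator is at most `2B
+ o(1)` whenever `sliceCorr f u ^ k ≤ B * sliceCorr f u ^ 2` with `0 ≤ B ≤ 1`. The two factors 2
cancel, so `2P - 1 ≤ B + o(1)`; then `B` is chosen from the largest correlation.

The difficulty is that the squared correlations sum to order `√n`, not 1, because the characters are
not orthogonal on `T`. With `t = n^(1/4)`, correlations are split at `1/t` and `1/t^3`. Large ones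
have square sum at most `2 + o(1)`, since the Gram matrix `slicePhi (u + v)` is nearly diagonal up
to the pairing of `u` with `u + 1`. Middle ones have bounded square sum, shown with the kernel
`dampedPhi`, whose off-diagonal entries are `O(n^-2)`. Small ones are controlled by Parseval. -/

/-! ### Walsh analysis on the cube. -/

/-- The nontrivial character of `ZMod 2`, with real values. -/
def signChar (a : ZMod 2) : ℝ := if a = 0 then 1 else -1

@[simp] lemma signChar_zero : signChar 0 = 1 := by simp [signChar]

@[simp] lemma signChar_one : signChar 1 = -1 := by simp [signChar]

lemma zmod_two_cases (a : ZMod 2) : a = 0 ∨ a = 1 := by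
  revert a; decide

lemma signChar_add (a b : ZMod 2) : signChar (a + b) = signChar a * signChar b := by
  have h : (1 + 1 : ZMod 2) = 0 := by decide
  rcases zmod_two_cases a with rfl | rfl <;> rcases zmod_two_cases b with rfl | rfl <;> simp [signChar, h]

lemma signChar_mul_self (a : ZMod 2) : signChar a * signChar a = 1 := by
  rcases zmod_two_cases a with rfl | rfl <;> simp [signChar]

lemma abs_signChar (a : ZMod 2) : |signChar a| = 1 := by
  rcases zmod_two_cases a with rfl | rfl <;> simp [signChar]

lemma signChar_sum {ι : Type*} (s : Finset ι) (a : ι → ZMod 2) :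
    signChar (∑ i ∈ s, a i) = ∏ i ∈ s, signChar (a i) := by
  classical
  induction s using Finset.induction_on with
  | empty => simp
  | insert i s hi ih => rw [Finset.sum_insert hi, Finset.prod_insert hi, signChar_add, ih]

lemma signChar_eq_ite (a b : ZMod 2) :
    signChar (a + b) = 2 * (if a = b then 1 else 0) - 1 := by
  have h : (1 + 1 : ZMod 2) = 0 := by decide
  rcases zmod_two_cases a with rfl | rfl <;> rcases zmod_two_cases b with rfl | rfl <;> simp [signChar, h] <;> norm_num

/-- Walsh characters of `𝔽₂^n`. -/
def walsh {n : ℕ} (u x : Fin n → ZMod 2) : ℝ := signChar (u ⬝ᵥ x)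

section Walsh

variable {n : ℕ}

lemma walsh_comm (u x : Fin n → ZMod 2) : walsh u x = walsh x u := by
  rw [walsh, walsh, dotProduct_comm]

lemma walsh_add_left (u v x : Fin n → ZMod 2) : walsh (u + v) x = walsh u x * walsh v x := by
  rw [walsh, add_dotProduct, signChar_add]; rfl

lemma walsh_add_right (u x y : Fin n → ZMod 2) : walsh u (x + y) = walsh u x * walsh u y := by
  rw [walsh, dotProduct_add, signChar_add]; rfl

@[simp] lemma walsh_zero_left (x : Fin n → ZMod 2) : walsh 0 x = 1 := by simp [walsh]

@[simp] lemma walsh_zero_right (u : Fin n → ZMod 2) : walsh u 0 = 1 := by simp [walsh]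

lemma walsh_sum_right {ι : Type*} (u : Fin n → ZMod 2) (s : Finset ι) (x : ι → Fin n → ZMod 2) :
    walsh u (∑ i ∈ s, x i) = ∏ i ∈ s, walsh u (x i) := by
  rw [walsh, dotProduct_sum, signChar_sum]; rfl

lemma walsh_single (i : Fin n) (x : Fin n → ZMod 2) :
    walsh (Pi.single i 1) x = signChar (x i) := by
  simp [walsh, single_dotProduct]

lemma abs_walsh (u x : Fin n → ZMod 2) : |walsh u x| = 1 := abs_signChar _

lemma add_self_cube (u : Fin n → ZMod 2) : u + u = 0 := by
  funext i; exact CharTwo.add_self_eq_zero (u i)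

lemma add_eq_zero_cube {u v : Fin n → ZMod 2} : u + v = 0 ↔ u = v := by
  constructor
  · intro h
    have : u + v + v = 0 + v := by rw [h]
    rwa [add_assoc, add_self_cube, add_zero, zero_add] at this
  · rintro rfl; exact add_self_cube u

lemma sum_walsh (u : Fin n → ZMod 2) :
    ∑ x, walsh u x = if u = 0 then (2 : ℝ) ^ n else 0 := by
  split_ifs with h
  · subst h; simp
  · obtain ⟨i, hi⟩ := Function.ne_iff.1 h
    have h1 : u i = 1 := (zmod_two_cases (u i)).resolve_left hi
    -- Translating by a basis vector in the support of `u` negates every term.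
    have h2 := (Equiv.sum_comp (Equiv.addRight (Pi.single i 1 : Fin n → ZMod 2)) (walsh u)).symm
    simp only [Equiv.coe_addRight] at h2
    have h3 : walsh u (Pi.single i 1) = -1 := by
      rw [walsh_comm, walsh_single, h1, signChar_one]
    simp only [walsh_add_right, h3, mul_neg, mul_one, Finset.sum_neg_distrib] at h2
    linarith

/-- The (unnormalised) Walsh transform. -/
def walshSum (g : (Fin n → ZMod 2) → ℝ) (u : Fin n → ZMod 2) : ℝ := ∑ x, g x * walsh u x

lemma sum_walshSum_mul_walsh (g : (Fin n → ZMod 2) → ℝ) (y : Fin n → ZMod 2) :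
    ∑ u, walshSum g u * walsh u y = 2 ^ n * g y := by
  simp only [walshSum, Finset.sum_mul]
  rw [Finset.sum_comm]
  have : ∀ x, ∑ u, g x * walsh u x * walsh u y = if x = y then 2 ^ n * g y else 0 := by
    intro x
    simp only [mul_assoc, ← walsh_add_right]
    rw [← Finset.mul_sum]
    simp only [fun u => walsh_comm u (x + y)]
    rw [sum_walsh]
    by_cases h : x = y
    · subst h; simp [add_self_cube, mul_comm]
    · simp [h, add_eq_zero_cube]
  simp [this]

/-- Expanding the power gives characters at sums of points, and summing over `u` is then Fourier
inversion at `∑ j, e (x j)`. -/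
lemma sum_walshSum_mul_pow {ι : Type*} [Fintype ι] (g : (Fin n → ZMod 2) → ℝ) (m : ℕ)
    (a : ι → ℝ) (e : ι → Fin n → ZMod 2) :
    ∑ u, walshSum g u * (∑ i, a i * walsh u (e i)) ^ m =
      2 ^ n * ∑ x : Fin m → ι, g (∑ j, e (x j)) * ∏ j, a (x j) := by
  rw [Finset.mul_sum]
  simp only [← mul_assoc, ← sum_walshSum_mul_walsh, Finset.sum_mul]
  rw [Finset.sum_comm]
  refine Finset.sum_congr rfl fun u _ => ?_
  rw [Fintype.sum_pow, Finset.mul_sum]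
  refine Finset.sum_congr rfl fun x _ => ?_
  rw [Finset.prod_mul_distrib, walsh_sum_right]
  ring

end Walsh

/-! ### Pass probability and agreement in terms of correlations. -/

lemma two_mul_uniformProb_eq_sub_one {Ω : Type} [Fintype Ω] [Nonempty Ω] (a b : Ω → ZMod 2) :
    2 * uniformProb (fun ω => a ω = b ω) - 1 =
      (∑ ω, signChar (a ω + b ω)) / (Fintype.card Ω : ℝ) := by
  have hc : (Fintype.card Ω : ℝ) ≠ 0 := by positivity
  rw [uniformProb, Nat.card_eq_fintype_card, Nat.card_eq_fintype_card, Fintype.card_subtype]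
  simp only [signChar_eq_ite, Finset.sum_sub_distrib, ← Finset.mul_sum, Finset.sum_boole]
  field_simp
  simp

lemma uniformProb_nonneg {Ω : Type} (p : Ω → Prop) : 0 ≤ uniformProb p := by
  unfold uniformProb; positivity

lemma uniformProb_le_one {Ω : Type} [Finite Ω] (p : Ω → Prop) : uniformProb p ≤ 1 := by
  unfold uniformProb
  refine div_le_one_of_le₀ ?_ (by positivity)
  exact_mod_cast Finite.card_subtype_le p

section Slice

variable {n : ℕ}

/-- The correlation of `(-1) ^ f` with a character on the half-slice. -/
noncomputable def sliceCorr (f : HalfSlice n → ZMod 2) (u : Fin n → ZMod 2) : ℝ :=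
  (∑ x : HalfSlice n, signChar (f x) * walsh u x.1) / (Fintype.card (HalfSlice n) : ℝ)

/-- Extension of a function on the half-slice by zero. -/
noncomputable def sliceExtend (a : HalfSlice n → ℝ) (x : Fin n → ZMod 2) : ℝ :=
  if h : hammingNorm x = n / 2 then a ⟨x, h⟩ else 0

instance : Nonempty (HalfSlice n) := by
  obtain ⟨s, -, hs⟩ := Finset.exists_subset_card_eq
    (show n / 2 ≤ (Finset.univ : Finset (Fin n)).card by simp; omega)
  refine ⟨⟨fun i => if i ∈ s then 1 else 0, ?_⟩⟩
  simp [hammingNorm, hs]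

lemma card_halfSlice_pos : (0 : ℝ) < Fintype.card (HalfSlice n) := by
  exact_mod_cast Fintype.card_pos

lemma card_halfSlice : Fintype.card (HalfSlice n) = n.choose (n / 2) := by
  rw [Fintype.card_subtype]
  have := Finset.card_powersetCard (n / 2) (Finset.univ : Finset (Fin n))
  rw [Finset.card_univ, Fintype.card_fin] at this
  rw [← this]
  refine Finset.card_bij' (fun x _ => Finset.univ.filter fun i => x i ≠ 0)
    (fun s _ i => if i ∈ s then 1 else 0) ?_ ?_ ?_ ?_
  · intro x hx
    simpa [Finset.mem_powersetCard, hammingNorm] using hx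
  · intro s hs
    simpa [Finset.mem_powersetCard, hammingNorm] using hs
  · intro x _
    funext i
    rcases zmod_two_cases (x i) with h | h <;> simp [h]
  · intro s _
    ext i; simp

lemma sum_sliceExtend_mul (a : HalfSlice n → ℝ) (b : (Fin n → ZMod 2) → ℝ) :
    ∑ x, sliceExtend a x * b x = ∑ x : HalfSlice n, a x * b x.1 := by
  rw [← Fintype.sum_subtype_add_sum_subtype (fun x : Fin n → ZMod 2 => hammingNorm x = n / 2)]
  have h2 : ∑ i : {x : Fin n → ZMod 2 // ¬ hammingNorm x = n / 2},
      sliceExtend a i.1 * b i.1 = 0 :=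
    Finset.sum_eq_zero fun i _ => by rw [sliceExtend, dif_neg i.2, zero_mul]
  rw [h2, add_zero]
  exact Finset.sum_congr rfl fun i _ => by rw [sliceExtend, dif_pos i.2]

lemma walshSum_sliceExtend (f : HalfSlice n → ZMod 2) (u : Fin n → ZMod 2) :
    walshSum (sliceExtend fun x => signChar (f x)) u =
      Fintype.card (HalfSlice n) * sliceCorr f u := by
  rw [walshSum, sum_sliceExtend_mul, sliceCorr, mul_div_cancel₀ _ card_halfSlice_pos.ne']

/-- One factor is kept as the transform of the zero extension and the other `m` are expanded; the
extension discards tuples whose sum leaves `T`. -/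
lemma sum_sliceCorr_pow (f : HalfSlice n → ZMod 2) (m : ℕ) :
    (Fintype.card (HalfSlice n) : ℝ) ^ (m + 1) * ∑ u, sliceCorr f u ^ (m + 1) =
      2 ^ n * ∑ x : Fin m → HalfSlice n,
        sliceExtend (fun x => signChar (f x)) (∑ j, (x j).1) * ∏ j, signChar (f (x j)) := by
  rw [← sum_walshSum_mul_pow (sliceExtend fun x => signChar (f x)) m (fun x => signChar (f x))
    (fun x : HalfSlice n => x.1), Finset.mul_sum]
  refine Finset.sum_congr rfl fun u _ => ?_
  rw [walshSum_sliceExtend, ← sum_sliceExtend_mul (fun x => signChar (f x)) (walsh u),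
    ← walshSum, walshSum_sliceExtend]
  ring

/-- Parseval, as the case `m = 1` of the power identity. -/
lemma sum_sliceCorr_sq (f : HalfSlice n → ZMod 2) :
    ∑ u, sliceCorr f u ^ 2 = 2 ^ n / Fintype.card (HalfSlice n) := by
  have h := sum_sliceCorr_pow f 1
  have h2 : ∑ x : Fin 1 → HalfSlice n,
        sliceExtend (fun x => signChar (f x)) (∑ j, (x j).1) * ∏ j, signChar (f (x j)) =
      Fintype.card (HalfSlice n) := by
    have : ∀ x : Fin 1 → HalfSlice n,
        sliceExtend (fun x => signChar (f x)) (∑ j, (x j).1) * ∏ j, signChar (f (x j)) = 1 := by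
      intro x
      have hx : hammingNorm (x 0).1 = n / 2 := (x 0).2
      simp [sliceExtend, hx, signChar_mul_self]
    rw [Finset.sum_congr rfl fun x _ => this x]
    simp
  rw [h2] at h
  have := card_halfSlice_pos (n := n)
  field_simp
  nlinarith [h]

lemma sum_sliceCorr_pow_eq_sum_sample (f : HalfSlice n → ZMod 2) {k : ℕ} (hk : 1 ≤ k) :
    (Fintype.card (HalfSlice n) : ℝ) ^ k * ∑ u, sliceCorr f u ^ k =
      2 ^ n * ∑ x : BLRSample k n,
        signChar (f ⟨∑ i, (x.1 i).1, x.2⟩ + ∑ i, f (x.1 i)) := by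
  obtain ⟨m, rfl⟩ : ∃ m, k = m + 1 := ⟨k - 1, by omega⟩
  rw [sum_sliceCorr_pow]
  congr 1
  change _ = ∑ x : {x : Fin m → HalfSlice n // hammingNorm (∑ i, (x i).1) = n / 2}, _
  rw [← Fintype.sum_subtype_add_sum_subtype
    (fun x : Fin m → HalfSlice n => hammingNorm (∑ i, (x i).1) = n / 2)]
  rw [add_eq_left.2]
  · refine Finset.sum_congr rfl fun x _ => ?_
    rw [sliceExtend, dif_pos x.2, signChar_add, signChar_sum]
    rfl
  · exact Finset.sum_eq_zero fun x _ => by rw [sliceExtend, dif_neg x.2, zero_mul]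

/-- The case `f = 0` counts the sample space, so comparing with it removes the normalisation.
Positivity of that sum makes the sample space nonempty. -/
lemma blrPassProb_mul_sum (f : HalfSlice n → ZMod 2) {k : ℕ} (hk : 1 ≤ k)
    (hpos : 0 < ∑ u, sliceCorr (0 : HalfSlice n → ZMod 2) u ^ k) :
    (2 * blrPassProb k f - 1) * ∑ u, sliceCorr (0 : HalfSlice n → ZMod 2) u ^ k =
      ∑ u, sliceCorr f u ^ k := by
  have h0 := sum_sliceCorr_pow_eq_sum_sample (0 : HalfSlice n → ZMod 2) hk
  have hf := sum_sliceCorr_pow_eq_sum_sample f hk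
  have hc : (0 : ℝ) < (Fintype.card (HalfSlice n) : ℝ) ^ k := pow_pos card_halfSlice_pos k
  simp only [Pi.zero_apply, Finset.sum_const_zero, add_zero, signChar_zero, Finset.sum_const,
    Finset.card_univ, nsmul_eq_mul, mul_one] at h0
  have h2 : (0 : ℝ) < 2 ^ n := by positivity
  have hN : (0 : ℝ) < Fintype.card (BLRSample k n) := by
    have : 0 < (2 : ℝ) ^ n * Fintype.card (BLRSample k n) := h0 ▸ mul_pos hc hpos
    exact pos_of_mul_pos_right this h2.le
  have : Nonempty (BLRSample k n) := Fintype.card_pos_iff.1 (by exact_mod_cast hN)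
  have hp := two_mul_uniformProb_eq_sub_one
    (fun x : BLRSample k n => f ⟨∑ i, (x.1 i).1, x.2⟩) (fun x => ∑ i, f (x.1 i))
  change 2 * blrPassProb k f - 1 = _ at hp
  rw [hp]
  apply mul_left_cancel₀ hc.ne'
  rw [hf, mul_left_comm, h0]
  field_simp

lemma affineAgreement_eq (f : HalfSlice n → ZMod 2) (u : Fin n → ZMod 2) (b : ZMod 2) :
    affineAgreement f u b = (1 + signChar b * sliceCorr f u) / 2 := by
  have h := two_mul_uniformProb_eq_sub_one f (fun x : HalfSlice n => u ⬝ᵥ x.1 + b)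
  change 2 * affineAgreement f u b - 1 = _ at h
  have h2 : ∑ x : HalfSlice n, signChar (f x + (u ⬝ᵥ x.1 + b)) =
      signChar b * ∑ x : HalfSlice n, signChar (f x) * walsh u x.1 := by
    rw [Finset.mul_sum]
    refine Finset.sum_congr rfl fun x _ => ?_
    rw [signChar_add, signChar_add, walsh]; ring
  rw [h2, mul_div_assoc, ← sliceCorr] at h
  linarith

lemma linearAgreement_eq (f : HalfSlice n → ZMod 2) (u : Fin n → ZMod 2) :
    linearAgreement f u = (1 + sliceCorr f u) / 2 := by
  have h := affineAgreement_eq f u 0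
  rw [signChar_zero, one_mul] at h
  rw [← h]
  unfold linearAgreement affineAgreement
  simp only [add_zero, dotProduct_comm]

lemma abs_sliceCorr_le_one (f : HalfSlice n → ZMod 2) (u : Fin n → ZMod 2) :
    |sliceCorr f u| ≤ 1 := by
  have h0 := affineAgreement_eq f u 0
  have h1 := affineAgreement_eq f u 1
  have h2 : 0 ≤ affineAgreement f u 0 := uniformProb_nonneg _
  have h3 : 0 ≤ affineAgreement f u 1 := uniformProb_nonneg _
  rw [h0, signChar_zero] at h2
  rw [h1, signChar_one] at h3
  rw [abs_le]; constructor <;> linarith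

/-- Inversion at the origin, which lies off the slice, shows that the correlations sum to 0. Hence
the maximal correlation is nonnegative. -/
lemma exists_sliceCorr_nonneg (hn : 2 ≤ n) (f : HalfSlice n → ZMod 2) :
    ∃ u, 0 ≤ sliceCorr f u := by
  have h := sum_walshSum_mul_walsh (sliceExtend fun x => signChar (f x)) 0
  have h0 : ¬ hammingNorm (0 : Fin n → ZMod 2) = n / 2 := by rw [hammingNorm_zero]; omega
  simp only [walshSum_sliceExtend, walsh_zero_right, mul_one, sliceExtend, dif_neg h0, mul_zero,
    ← Finset.mul_sum] at h
  have h1 := (mul_eq_zero.1 h).resolve_left card_halfSlice_pos.ne'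
  by_contra! hc
  exact absurd h1 (Finset.sum_neg (fun u _ => hc u) Finset.univ_nonempty).ne

end Slice

/-! ### The Walsh transform of the slice and its damped version. -/

section Kernel

variable {n : ℕ}

lemma hammingNorm_add_single_of_eq_zero {u : Fin n → ZMod 2} {i : Fin n} (h : u i = 0) :
    hammingNorm (u + Pi.single i 1) = hammingNorm u + 1 := by
  rw [hammingNorm, hammingNorm, ← Finset.card_insert_of_notMem (a := i) (by simp [h])]
  congr 1
  ext j
  by_cases hj : j = i
  · subst hj; simp [h]
  · simp [hj]

lemma hammingNorm_add_single_of_ne_zero {u : Fin n → ZMod 2} {i : Fin n} (h : u i ≠ 0) :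
    hammingNorm (u + Pi.single i 1) + 1 = hammingNorm u := by
  have h2 : (u + Pi.single i 1 : Fin n → ZMod 2) i = 0 := by
    rw [Pi.add_apply, Pi.single_eq_same, (zmod_two_cases (u i)).resolve_left h]; decide
  rw [← hammingNorm_add_single_of_eq_zero h2, add_assoc, add_self_cube, add_zero]

lemma hammingNorm_add_one (u : Fin n → ZMod 2) :
    hammingNorm (u + 1) + hammingNorm u = n := by
  have h : ∀ a : ZMod 2, a + 1 ≠ 0 ↔ ¬ a ≠ 0 := by decide
  have := Finset.card_filter_add_card_filter_not (s := (Finset.univ : Finset (Fin n)))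
    (fun i => u i ≠ 0)
  simp only [hammingNorm, Pi.add_apply, Pi.one_apply, h]
  rw [Finset.card_univ, Fintype.card_fin] at this
  omega

lemma hammingNorm_eq_iff_eq_one {u : Fin n → ZMod 2} : hammingNorm u = n ↔ u = 1 := by
  have h := hammingNorm_add_one u
  have h1 : (1 + 1 : Fin n → ZMod 2) = 0 := add_self_cube 1
  constructor
  · intro hu
    have : hammingNorm (u + 1) = 0 := by omega
    exact add_eq_zero_cube.1 (hammingNorm_eq_zero.1 this)
  · rintro rfl
    rw [h1, hammingNorm_zero] at h
    omega

lemma sum_signChar_eq (x : Fin n → ZMod 2) :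
    ∑ i, signChar (x i) = n - 2 * hammingNorm x := by
  have : ∀ a : ZMod 2, signChar a = 1 - 2 * (if a ≠ 0 then 1 else 0) := by
    intro a
    rcases zmod_two_cases a with rfl | rfl <;> norm_num
  simp only [this, Finset.sum_sub_distrib, ← Finset.mul_sum, Finset.sum_boole]
  simp [hammingNorm]

lemma sum_signChar_halfSlice (hn : Even n) (x : HalfSlice n) :
    ∑ i, signChar (x.1 i) = 0 := by
  obtain ⟨m, rfl⟩ := hn
  rw [sum_signChar_eq, x.2, show (m + m) / 2 = m by omega]
  push_cast; ring

lemma walsh_one (x : Fin n → ZMod 2) : walsh 1 x = (-1) ^ hammingNorm x := by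
  rw [walsh, one_dotProduct, signChar_sum, hammingNorm, ← Finset.prod_const,
    Finset.prod_filter]
  refine Finset.prod_congr rfl fun i _ => ?_
  rcases zmod_two_cases (x i) with h | h <;> simp [h]

lemma exists_perm_of_hammingNorm_eq {u v : Fin n → ZMod 2} (h : hammingNorm u = hammingNorm v) :
    ∃ σ : Equiv.Perm (Fin n), u = v ∘ σ := by
  have hc : Fintype.card {i // u i ≠ 0} = Fintype.card {i // v i ≠ 0} := by
    simpa only [Fintype.card_subtype, hammingNorm] using h
  let e := Fintype.equivOfCardEq hc
  refine ⟨e.extendSubtype, funext fun i => ?_⟩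
  by_cases hi : u i = 0
  · have h2 := e.extendSubtype_not_mem i (not_not.2 hi)
    rw [Function.comp_apply, not_not.1 h2, hi]
  · have h2 := e.extendSubtype_mem i hi
    rw [Function.comp_apply, (zmod_two_cases _).resolve_left h2,
      (zmod_two_cases _).resolve_left hi]

/-- The normalised Walsh transform of the uniform measure on the half-slice. -/
noncomputable def slicePhi (u : Fin n → ZMod 2) : ℝ := sliceCorr (0 : HalfSlice n → ZMod 2) u

lemma slicePhi_eq (u : Fin n → ZMod 2) :
    slicePhi u = (∑ x : HalfSlice n, walsh u x.1) / (Fintype.card (HalfSlice n) : ℝ) := by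
  simp [slicePhi, sliceCorr]

lemma slicePhi_zero : slicePhi (0 : Fin n → ZMod 2) = 1 := by
  have := card_halfSlice_pos (n := n)
  rw [slicePhi_eq]
  simp only [walsh_zero_left, Finset.sum_const, Finset.card_univ, nsmul_eq_mul, mul_one]
  exact div_self this.ne'

lemma slicePhi_add_one (u : Fin n → ZMod 2) :
    slicePhi (u + 1) = (-1) ^ (n / 2) * slicePhi u := by
  rw [slicePhi_eq, slicePhi_eq, ← mul_div_assoc, Finset.mul_sum]
  congr 1
  refine Finset.sum_congr rfl fun x _ => ?_
  rw [walsh_add_left, walsh_one, x.2, mul_comm]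

lemma hammingNorm_comp_perm (x : Fin n → ZMod 2) (σ : Equiv.Perm (Fin n)) :
    hammingNorm (x ∘ σ) = hammingNorm x := by
  rw [hammingNorm, hammingNorm]
  refine Finset.card_equiv σ fun i => ?_
  simp

lemma slicePhi_comp_perm (u : Fin n → ZMod 2) (σ : Equiv.Perm (Fin n)) :
    slicePhi (u ∘ σ) = slicePhi u := by
  rw [slicePhi_eq, slicePhi_eq]
  congr 1
  refine Fintype.sum_equiv ⟨fun x => ⟨x.1 ∘ σ.symm, (hammingNorm_comp_perm _ _).trans x.2⟩,
    fun x => ⟨x.1 ∘ σ, (hammingNorm_comp_perm _ _).trans x.2⟩, fun x => ?_, fun x => ?_⟩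
    _ _ fun x => ?_
  · ext i; simp
  · ext i; simp
  · simp only [Equiv.coe_fn_mk, walsh]
    rw [dotProduct_comm, dotProduct_comm u, comp_equiv_symm_dotProduct]

lemma exists_slicePhi_eq_hammingNorm :
    ∃ c : ℕ → ℝ, ∀ u : Fin n → ZMod 2, slicePhi u = c (hammingNorm u) := by
  classical
  refine ⟨fun j => if h : ∃ v : Fin n → ZMod 2, hammingNorm v = j then slicePhi h.choose else 0,
    fun u => ?_⟩
  have h : ∃ v : Fin n → ZMod 2, hammingNorm v = hammingNorm u := ⟨u, rfl⟩
  obtain ⟨σ, hσ⟩ := exists_perm_of_hammingNorm_eq h.choose_spec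
  dsimp only
  rw [dif_pos h, ← slicePhi_comp_perm u σ, ← hσ]

lemma exists_hammingNorm_eq {j : ℕ} (hj : j ≤ n) : ∃ u : Fin n → ZMod 2, hammingNorm u = j := by
  obtain ⟨s, -, hs⟩ := Finset.exists_subset_card_eq
    (show j ≤ (Finset.univ : Finset (Fin n)).card by simpa using hj)
  exact ⟨fun i => if i ∈ s then 1 else 0, by simp [hammingNorm, hs]⟩

/-- The sum over `i` multiplies the integrand by `n - 2|x|`, which is 0 on the slice. -/
lemma sum_slicePhi_add_single (hn : Even n) (u : Fin n → ZMod 2) :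
    ∑ i, slicePhi (u + Pi.single i 1) = 0 := by
  simp only [slicePhi_eq]
  rw [← Finset.sum_div, Finset.sum_comm, Finset.sum_eq_zero, zero_div]
  intro x _
  simp only [walsh_add_left, walsh_single]
  rw [← Finset.mul_sum, sum_signChar_halfSlice hn, mul_zero]

/-- At weight 0 the truncated `hammingNorm u - 1` is harmless, its coefficient being 0. -/
lemma sum_add_single_eq {c : ℕ → ℝ} (u : Fin n → ZMod 2) :
    ∑ i, c (hammingNorm (u + Pi.single i 1)) =
      hammingNorm u * c (hammingNorm u - 1) + (n - hammingNorm u) * c (hammingNorm u + 1) := by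
  have h : ∀ i, c (hammingNorm (u + Pi.single i 1)) =
      if u i ≠ 0 then c (hammingNorm u - 1) else c (hammingNorm u + 1) := by
    intro i
    split_ifs with hi
    · rw [← hammingNorm_add_single_of_ne_zero hi, Nat.add_sub_cancel]
    · rw [hammingNorm_add_single_of_eq_zero (not_not.1 hi)]
  have h2 := Finset.card_filter_add_card_filter_not (s := (Finset.univ : Finset (Fin n)))
    (fun i => u i ≠ 0)
  rw [Finset.card_univ, Fintype.card_fin] at h2
  have h3 : (n : ℝ) - hammingNorm u = (Finset.univ.filter fun i => ¬ u i ≠ 0).card := by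
    rw [sub_eq_iff_eq_add']; exact_mod_cast h2.symm
  rw [h3]
  simp only [h, Finset.sum_ite, Finset.sum_const, nsmul_eq_mul]
  rfl

lemma slicePhi_weight_recurrence (hn : Even n) {c : ℕ → ℝ}
    (hc : ∀ u : Fin n → ZMod 2, slicePhi u = c (hammingNorm u)) {j : ℕ} (hj : j ≤ n) :
    (j : ℝ) * c (j - 1) + (n - j) * c (j + 1) = 0 := by
  obtain ⟨u, rfl⟩ := exists_hammingNorm_eq hj
  rw [← sum_add_single_eq, ← sum_slicePhi_add_single hn u]
  exact Finset.sum_congr rfl fun i _ => (hc _).symm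

/-- The values of `slicePhi` on vectors of weight at most half the dimension. -/
lemma slicePhi_weight_bounds (hn : Even n) (h8 : 8 ≤ n) {c : ℕ → ℝ}
    (hc : ∀ u : Fin n → ZMod 2, slicePhi u = c (hammingNorm u)) :
    c 1 = 0 ∧ c 2 = -1 / (n - 1) ∧ c 3 = 0 ∧
      ∀ j, 4 ≤ j → 2 * j ≤ n → |c j| ≤ 3 / ((n - 1) * (n - 3)) := by
  have hn8 : (8 : ℝ) ≤ n := by exact_mod_cast h8
  have h0 : c 0 = 1 := by
    have := hc 0
    rwa [slicePhi_zero, hammingNorm_zero, eq_comm] at this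
  have r : ∀ j : ℕ, j + 1 ≤ n → (j + 1 : ℝ) * c j + (n - (j + 1)) * c (j + 2) = 0 := by
    intro j hj
    have := slicePhi_weight_recurrence hn hc hj
    simpa using this
  have h1 : c 1 = 0 := by
    have := slicePhi_weight_recurrence hn hc (Nat.zero_le n)
    simp only [Nat.cast_zero, zero_mul, sub_zero, zero_add] at this
    exact (mul_eq_zero.1 this).resolve_left (by linarith)
  have e1 : (n : ℝ) - 1 ≠ 0 := by linarith
  have e3 : (n : ℝ) - 3 ≠ 0 := by linarith
  have h2 : c 2 = -1 / (n - 1) := by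
    have := r 0 (by omega)
    rw [h0] at this
    rw [eq_div_iff e1]
    norm_num at this
    linarith
  have h3 : c 3 = 0 := by
    have := r 1 (by omega)
    rw [h1, mul_zero, zero_add] at this
    refine (mul_eq_zero.1 this).resolve_left ?_
    norm_num; linarith
  have h4 : c 4 = 3 / ((n - 1) * (n - 3)) := by
    have := r 2 (by omega)
    rw [h2] at this
    field_simp at this ⊢
    norm_num at this
    linarith
  have h5 : c 5 = 0 := by
    have := r 3 (by omega)
    rw [h3, mul_zero, zero_add] at this
    refine (mul_eq_zero.1 this).resolve_left ?_
    norm_num; linarith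
  have hb : (0 : ℝ) ≤ 3 / ((n - 1) * (n - 3)) :=
    div_nonneg (by norm_num) (mul_nonneg (by linarith) (by linarith))
  refine ⟨h1, h2, h3, fun j hj => ?_⟩
  induction j using Nat.strong_induction_on with
  | _ j ih =>
    intro hjn
    by_cases j4 : j = 4
    · rw [j4, h4, abs_of_nonneg hb]
    by_cases j5 : j = 5
    · rw [j5, h5, abs_zero]; exact hb
    obtain ⟨i, rfl⟩ : ∃ i, j = i + 2 := ⟨j - 2, by omega⟩
    have h := ih i (by omega) (by omega) (by omega)
    -- The recurrence gives `|c (i+2)| = (i+1)/(n-i-1) * |c i|`, a ratio at most 1 in the lower half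
    -- of the weights.
    refine le_trans ?_ h
    have hr := r i (by omega)
    have hi : (2 * (i + 2) : ℝ) ≤ n := by exact_mod_cast hjn
    have hpos : (0 : ℝ) < i + 1 := by positivity
    have key : (n - (i + 1) : ℝ) * |c (i + 2)| = (i + 1) * |c i| := by
      have hpos' : (0 : ℝ) < n - (i + 1) := by linarith
      have h' : (n - (i + 1) : ℝ) * c (i + 2) = -((i + 1) * c i) := by linarith
      have := congrArg abs h'
      rwa [abs_neg, abs_mul, abs_mul, abs_of_pos hpos, abs_of_pos hpos'] at this
    have hm : (i + 1 : ℝ) * |c (i + 2)| ≤ (n - (i + 1)) * |c (i + 2)| :=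
      mul_le_mul_of_nonneg_right (by linarith) (abs_nonneg _)
    rw [key] at hm
    exact le_of_mul_le_mul_left hm hpos

/-- The number of neighbours of weight one; the Walsh transform of `(n - 2|x|)²`. -/
noncomputable def neighborCount (u : Fin n → ZMod 2) : ℝ :=
  ∑ i : Fin n, if hammingNorm (u + Pi.single i 1) = 1 then 1 else 0

lemma neighborCount_eq (u : Fin n → ZMod 2) :
    neighborCount u = if hammingNorm u = 0 then (n : ℝ) else if hammingNorm u = 2 then 2 else 0 := by
  have h := sum_add_single_eq (c := fun j => if j = 1 then 1 else 0) u
  rw [neighborCount, h]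
  generalize hammingNorm u = w
  rcases w with _ | _ | _ | w <;> simp

lemma hammingNorm_eq_one_iff {u : Fin n → ZMod 2} :
    hammingNorm u = 1 ↔ ∃ i, u = Pi.single i 1 := by
  constructor
  · intro h
    have hu : u ≠ 0 := by rintro rfl; simp at h
    obtain ⟨i, hi⟩ := Function.ne_iff.1 hu
    have := hammingNorm_add_single_of_ne_zero hi
    exact ⟨i, add_eq_zero_cube.1 (hammingNorm_eq_zero.1 (by omega))⟩
  · rintro ⟨i, rfl⟩
    have := hammingNorm_add_single_of_eq_zero (u := (0 : Fin n → ZMod 2)) (i := i) rfl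
    simpa using this

/-- The square is the sum over `i, j` of the characters of `e_i + e_j`, so orthogonality leaves the
pairs with `u = e_i + e_j`. -/
lemma sum_walsh_mul_sq (u : Fin n → ZMod 2) :
    ∑ x, walsh u x * (∑ i, signChar (x i)) ^ 2 = 2 ^ n * neighborCount u := by
  have hexp : ∀ x, walsh u x * (∑ i, signChar (x i)) ^ 2 =
      ∑ i, ∑ j, walsh (u + Pi.single i 1 + Pi.single j 1) x := by
    intro x
    rw [sq, Finset.sum_mul_sum]
    simp only [walsh_add_left, walsh_single, Finset.mul_sum, mul_assoc]
  simp only [hexp]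
  rw [Finset.sum_comm, neighborCount, Finset.mul_sum]
  refine Finset.sum_congr rfl fun i _ => ?_
  rw [Finset.sum_comm]
  simp only [sum_walsh, add_eq_zero_cube]
  split_ifs with h
  · obtain ⟨j, hj⟩ := hammingNorm_eq_one_iff.1 h
    have : ∀ k : Fin n, (u + Pi.single i 1 = Pi.single k 1) ↔ k = j := by
      intro k
      rw [hj]
      constructor
      · intro hk
        by_contra hne
        have := congrFun hk k
        simp [hne] at this
      · rintro rfl; rfl
    simp [this]
  · rw [mul_zero]
    refine Finset.sum_eq_zero fun k _ => if_neg fun hk => h (hammingNorm_eq_one_iff.2 ⟨k, hk⟩)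

/-- The transform of the slice measure plus a nonnegative function that vanishes on the slice,
chosen to cancel the values of `slicePhi` in weights `2` and `n - 2`. -/
noncomputable def dampedPhi (u : Fin n → ZMod 2) : ℝ :=
  slicePhi u + (neighborCount u + (-1) ^ (n / 2) * neighborCount (u + 1)) / (2 * (n - 1))

lemma abs_neg_one_pow_mul (m : ℕ) (a : ℝ) : |(-1) ^ m * a| = |a| := by
  rw [abs_mul, abs_pow, abs_neg, abs_one, one_pow, one_mul]

lemma add_one_add_one (u : Fin n → ZMod 2) : u + 1 + 1 = u := by
  rw [add_assoc, add_self_cube, add_zero]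

lemma abs_slicePhi_add_one (u : Fin n → ZMod 2) : |slicePhi (u + 1)| = |slicePhi u| := by
  rw [slicePhi_add_one, abs_neg_one_pow_mul]

lemma abs_dampedPhi_add_one (u : Fin n → ZMod 2) : |dampedPhi (u + 1)| = |dampedPhi u| := by
  have : dampedPhi (u + 1) = (-1) ^ (n / 2) * dampedPhi u := by
    have h : ((-1 : ℝ) ^ (n / 2)) * (-1) ^ (n / 2) = 1 := by
      rw [← mul_pow]; norm_num
    rw [dampedPhi, dampedPhi, slicePhi_add_one, add_one_add_one, mul_add, ← mul_div_assoc,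
      mul_add, ← mul_assoc ((-1 : ℝ) ^ (n / 2)) _ (neighborCount (u + 1)), h]
    ring
  rw [this, abs_neg_one_pow_mul]

/-- A property invariant under `u ↦ u + 1` may be checked on vectors of weight at most `n / 2`. -/
lemma of_hammingNorm_le_half {P : (Fin n → ZMod 2) → Prop} (hP : ∀ u, P (u + 1) → P u)
    (h : ∀ u, 2 * hammingNorm u ≤ n → P u) (u : Fin n → ZMod 2) : P u := by
  by_cases hu : 2 * hammingNorm u ≤ n
  · exact h u hu
  · refine hP u (h _ ?_)
    have := hammingNorm_add_one u
    omega

lemma abs_slicePhi_le (hn : Even n) (h8 : 8 ≤ n) (u : Fin n → ZMod 2) (h0 : u ≠ 0) (h1 : u ≠ 1) :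
    |slicePhi u| ≤ 1 / (n - 1) := by
  revert h0 h1
  refine of_hammingNorm_le_half (P := fun u => u ≠ 0 → u ≠ 1 → |slicePhi u| ≤ 1 / (n - 1))
    ?_ ?_ u
  · intro v hv h0 h1
    rw [← abs_slicePhi_add_one]
    refine hv (fun h => h1 (add_eq_zero_cube.1 h)) fun h => h0 ?_
    rw [← add_one_add_one v, h, add_self_cube]
  · intro v hv h0 _
    obtain ⟨c, hc⟩ := exists_slicePhi_eq_hammingNorm (n := n)
    obtain ⟨c1, c2, c3, c4⟩ := slicePhi_weight_bounds hn h8 hc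
    have hn8 : (8 : ℝ) ≤ n := by exact_mod_cast h8
    have hp1 : (0 : ℝ) < n - 1 := by linarith
    have hp3 : (0 : ℝ) < n - 3 := by linarith
    rw [hc v]
    have hne : hammingNorm v ≠ 0 := hammingNorm_ne_zero_iff.2 h0
    generalize hammingNorm v = w at *
    have hw : w = 1 ∨ w = 2 ∨ w = 3 ∨ 4 ≤ w := by omega
    rcases hw with rfl | rfl | rfl | hw
    · rw [c1, abs_zero]; positivity
    · rw [c2, abs_div, abs_neg, abs_one, abs_of_pos hp1]
    · rw [c3, abs_zero]; positivity
    · refine (c4 w hw hv).trans ?_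
      rw [div_le_div_iff₀ (mul_pos hp1 hp3) hp1]
      nlinarith

lemma abs_dampedPhi_le (hn : Even n) (h8 : 8 ≤ n) (u : Fin n → ZMod 2) :
    |dampedPhi u| ≤ if u = 0 ∨ u = 1 then 2 else 3 / (((n : ℝ) - 1) * (n - 3)) := by
  refine of_hammingNorm_le_half (P := fun u => |dampedPhi u| ≤
    if u = 0 ∨ u = 1 then 2 else 3 / (((n : ℝ) - 1) * (n - 3))) ?_ ?_ u
  · intro v hv
    rw [← abs_dampedPhi_add_one]
    refine hv.trans (le_of_eq (if_congr ?_ rfl rfl))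
    have e0 : v + 1 = 0 ↔ v = 1 := add_eq_zero_cube
    have e1 : v + 1 = 1 ↔ v = 0 := by simp
    rw [e0, e1, or_comm]
  · intro v hv
    obtain ⟨c, hc⟩ := exists_slicePhi_eq_hammingNorm (n := n)
    obtain ⟨c1, c2, c3, c4⟩ := slicePhi_weight_bounds hn h8 hc
    have hn8 : (8 : ℝ) ≤ n := by exact_mod_cast h8
    have hp1 : (0 : ℝ) < n - 1 := by linarith
    have hp3 : (0 : ℝ) < n - 3 := by linarith
    -- Since `2|v| ≤ n` and `n ≥ 8`, the vector `v + 1` has weight at least 4, so the reflected term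
    -- vanishes.
    have hv1 := hammingNorm_add_one v
    have hk : neighborCount (v + 1) = 0 := by
      rw [neighborCount_eq, if_neg (by omega), if_neg (by omega)]
    have hne1 : v ≠ 1 := fun h => by
      have := hammingNorm_eq_iff_eq_one.2 h
      omega
    rw [dampedPhi, hk, mul_zero, add_zero, neighborCount_eq]
    by_cases h0 : v = 0
    · subst h0
      rw [if_pos (Or.inl rfl), if_pos hammingNorm_zero, slicePhi_zero, abs_of_pos (by positivity),
        ← le_sub_iff_add_le', div_le_iff₀ (by linarith)]
      linarith
    · have hne : hammingNorm v ≠ 0 := hammingNorm_ne_zero_iff.2 h0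
      rw [if_neg hne, if_neg (show ¬ (v = 0 ∨ v = 1) by tauto), hc v]
      generalize hammingNorm v = w at *
      have hw : w = 1 ∨ w = 2 ∨ w = 3 ∨ 4 ≤ w := by omega
      rcases hw with rfl | rfl | rfl | hw
      · rw [c1]; simp; positivity
      · rw [c2, if_pos rfl]
        have : -1 / ((n : ℝ) - 1) + 2 / (2 * (n - 1)) = 0 := by field_simp; norm_num
        rw [this, abs_zero]; positivity
      · rw [c3]; simp; positivity
      · rw [if_neg (by omega), zero_div, add_zero]
        exact c4 w hw hv

end Kernel

/-! ### Square sums of correlations over sets of characters. -/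

section LargeSpectrum

variable {n : ℕ}

lemma sum_sum_mul_walsh (S : Finset (Fin n → ZMod 2)) (w : (Fin n → ZMod 2) → ℝ)
    (x : Fin n → ZMod 2) :
    (∑ u ∈ S, w u * walsh u x) ^ 2 = ∑ u ∈ S, ∑ v ∈ S, w u * w v * walsh (u + v) x := by
  rw [sq, Finset.sum_mul_sum]
  refine Finset.sum_congr rfl fun u _ => Finset.sum_congr rfl fun v _ => ?_
  rw [walsh_add_left]; ring

lemma sum_sum_mul_sum_walsh {ι : Type*} [Fintype ι] (S : Finset (Fin n → ZMod 2))
    (w : (Fin n → ZMod 2) → ℝ) (e : ι → Fin n → ZMod 2) (ρ : ι → ℝ) :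
    ∑ u ∈ S, ∑ v ∈ S, w u * w v * ∑ x, walsh (u + v) (e x) * ρ x =
      ∑ x, (∑ u ∈ S, w u * walsh u (e x)) ^ 2 * ρ x := by
  simp only [sum_sum_mul_walsh, Finset.sum_mul, Finset.mul_sum]
  symm
  rw [Finset.sum_comm]
  refine Finset.sum_congr rfl fun u _ => ?_
  rw [Finset.sum_comm]
  refine Finset.sum_congr rfl fun v _ => Finset.sum_congr rfl fun x _ => ?_
  rw [mul_assoc]

/-- Quadratic form of the Gram matrix of the characters on the half-slice. -/
lemma sum_sum_mul_slicePhi (S : Finset (Fin n → ZMod 2)) (w : (Fin n → ZMod 2) → ℝ) :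
    ∑ u ∈ S, ∑ v ∈ S, w u * w v * slicePhi (u + v) =
      (∑ x : HalfSlice n, (∑ u ∈ S, w u * walsh u x.1) ^ 2) / Fintype.card (HalfSlice n) := by
  have h := sum_sum_mul_sum_walsh S w (fun x : HalfSlice n => x.1) fun _ => 1
  simp only [mul_one] at h
  simp only [← h, slicePhi_eq, Finset.sum_div, mul_div_assoc]

/-- The left sum is the mean of `(-1)^f * g` with `g = ∑ u ∈ S, sliceCorr f u * walsh u`; by
Cauchy–Schwarz its square is at most the mean of `g²`, which is the Gram form. -/
lemma sq_sum_sliceCorr_sq_le (f : HalfSlice n → ZMod 2) (S : Finset (Fin n → ZMod 2)) :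
    (∑ u ∈ S, sliceCorr f u ^ 2) ^ 2 ≤
      ∑ u ∈ S, ∑ v ∈ S, sliceCorr f u * sliceCorr f v * slicePhi (u + v) := by
  have hN := card_halfSlice_pos (n := n)
  have h1 : ∑ u ∈ S, sliceCorr f u ^ 2 = (∑ x : HalfSlice n, signChar (f x) *
      ∑ u ∈ S, sliceCorr f u * walsh u x.1) / Fintype.card (HalfSlice n) := by
    simp only [Finset.mul_sum]
    rw [Finset.sum_comm, Finset.sum_div]
    refine Finset.sum_congr rfl fun u _ => ?_
    rw [sq]
    nth_rewrite 2 [sliceCorr]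
    rw [← mul_div_assoc, Finset.mul_sum]
    congr 1
    exact Finset.sum_congr rfl fun x _ => by ring
  have h2 := Finset.sum_mul_sq_le_sq_mul_sq Finset.univ (fun x : HalfSlice n => signChar (f x))
    (fun x => ∑ u ∈ S, sliceCorr f u * walsh u x.1)
  have h3 : ∑ x : HalfSlice n, signChar (f x) ^ 2 = Fintype.card (HalfSlice n) := by
    simp [sq, signChar_mul_self]
  rw [h3] at h2
  rw [sum_sum_mul_slicePhi, h1, div_pow, div_le_div_iff₀ (by positivity) hN]
  nlinarith [mul_le_mul_of_nonneg_right h2 hN.le]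

/-- The added kernel is a positive multiple of the transform of `(n - 2|x|)² (1 + (-1)^(n/2 + |x|))
≥ 0`, hence positive semidefinite. -/
lemma sum_sum_mul_slicePhi_le_dampedPhi (hn1 : 1 < n) (S : Finset (Fin n → ZMod 2))
    (w : (Fin n → ZMod 2) → ℝ) :
    ∑ u ∈ S, ∑ v ∈ S, w u * w v * slicePhi (u + v) ≤
      ∑ u ∈ S, ∑ v ∈ S, w u * w v * dampedPhi (u + v) := by
  have hn : (0 : ℝ) < 2 * (n - 1) := by
    have : (1 : ℝ) < n := by exact_mod_cast hn1
    linarith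
  have h1 : ∀ u : Fin n → ZMod 2,
      2 ^ n * (neighborCount u + (-1) ^ (n / 2) * neighborCount (u + 1)) =
      ∑ x, walsh u x * ((∑ i, signChar (x i)) ^ 2 * (1 + (-1) ^ (n / 2) * walsh 1 x)) := by
    intro u
    rw [mul_add, mul_left_comm, ← sum_walsh_mul_sq, ← sum_walsh_mul_sq, Finset.mul_sum,
      ← Finset.sum_add_distrib]
    refine Finset.sum_congr rfl fun x _ => ?_
    rw [walsh_add_left]; ring
  have h2 : 0 ≤ ∑ u ∈ S, ∑ v ∈ S, w u * w v *
      (2 ^ n * (neighborCount (u + v) + (-1) ^ (n / 2) * neighborCount (u + v + 1))) := by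
    have : ∑ u ∈ S, ∑ v ∈ S, w u * w v *
        (2 ^ n * (neighborCount (u + v) + (-1) ^ (n / 2) * neighborCount (u + v + 1))) =
        ∑ x, (∑ u ∈ S, w u * walsh u x) ^ 2 *
          ((∑ i, signChar (x i)) ^ 2 * (1 + (-1) ^ (n / 2) * walsh 1 x)) := by
      simp only [h1]
      exact sum_sum_mul_sum_walsh S w id _
    rw [this]
    refine Finset.sum_nonneg fun x _ => mul_nonneg (sq_nonneg _) (mul_nonneg (sq_nonneg _) ?_)
    have : |(-1) ^ (n / 2) * walsh 1 x| ≤ 1 := by rw [abs_neg_one_pow_mul, abs_walsh]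
    linarith [(abs_le.1 this).1]
  have h3 : ∑ u ∈ S, ∑ v ∈ S, w u * w v * dampedPhi (u + v) =
      ∑ u ∈ S, ∑ v ∈ S, w u * w v * slicePhi (u + v) + (∑ u ∈ S, ∑ v ∈ S, w u * w v *
      (2 ^ n * (neighborCount (u + v) + (-1) ^ (n / 2) * neighborCount (u + v + 1)))) /
        (2 ^ n * (2 * (n - 1))) := by
    simp only [Finset.sum_div, ← Finset.sum_add_distrib]
    refine Finset.sum_congr rfl fun u _ => Finset.sum_congr rfl fun v _ => ?_
    rw [dampedPhi]
    field_simp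
  rw [h3]
  have : 0 ≤ (2 : ℝ) ^ n * (2 * (n - 1)) := by positivity
  linarith [div_nonneg h2 this]

/-- Schur test for a translation-invariant kernel concentrated near `{0, 1}`. -/
lemma sum_sum_mul_kernel_le (S : Finset (Fin n → ZMod 2)) (w M : (Fin n → ZMod 2) → ℝ)
    {a b : ℝ} (ha : 0 ≤ a) (hb : 0 ≤ b) (hM : ∀ u, |M u| ≤ if u = 0 ∨ u = 1 then a else b) :
    ∑ u ∈ S, ∑ v ∈ S, w u * w v * M (u + v) ≤ (2 * a + b * S.card) * ∑ u ∈ S, w u ^ 2 := by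
  have row : ∀ u, ∑ v ∈ S, |M (u + v)| ≤ 2 * a + b * S.card := by
    intro u
    calc ∑ v ∈ S, |M (u + v)|
        ≤ ∑ v ∈ S, ((if v = u then a else 0) + (if v = u + 1 then a else 0) + b) := by
          refine Finset.sum_le_sum fun v _ => (hM _).trans ?_
          have e0 : u + v = 0 ↔ v = u := add_eq_zero_cube.trans eq_comm
          have e1 : u + v = 1 ↔ v = u + 1 := by
            rw [← add_eq_zero_cube, add_assoc, add_comm v, ← add_assoc, add_eq_zero_cube, eq_comm]
          simp only [e0, e1]
          split_ifs <;> first | linarith | tauto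
      _ ≤ 2 * a + b * S.card := by
          rw [Finset.sum_add_distrib, Finset.sum_add_distrib, Finset.sum_ite_eq',
            Finset.sum_ite_eq', Finset.sum_const, nsmul_eq_mul]
          split_ifs <;> linarith
  calc ∑ u ∈ S, ∑ v ∈ S, w u * w v * M (u + v)
      ≤ ∑ u ∈ S, ∑ v ∈ S, (w u ^ 2 / 2 * |M (u + v)| + w v ^ 2 / 2 * |M (u + v)|) := by
        refine Finset.sum_le_sum fun u _ => Finset.sum_le_sum fun v _ => ?_
        have h1 : |w u * w v| ≤ w u ^ 2 / 2 + w v ^ 2 / 2 := by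
          rw [abs_mul, ← sq_abs (w u), ← sq_abs (w v)]
          nlinarith [sq_nonneg (|w u| - |w v|)]
        calc w u * w v * M (u + v) ≤ |w u * w v| * |M (u + v)| := by
              rw [← abs_mul]; exact le_abs_self _
          _ ≤ (w u ^ 2 / 2 + w v ^ 2 / 2) * |M (u + v)| :=
              mul_le_mul_of_nonneg_right h1 (abs_nonneg _)
          _ = _ := by ring
    _ = ∑ u ∈ S, w u ^ 2 * ∑ v ∈ S, |M (u + v)| := by
        simp only [Finset.sum_add_distrib]
        rw [Finset.sum_comm (f := fun u v => w v ^ 2 / 2 * |M (u + v)|), ← Finset.sum_add_distrib]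
        refine Finset.sum_congr rfl fun u _ => ?_
        rw [Finset.mul_sum, ← Finset.sum_add_distrib]
        refine Finset.sum_congr rfl fun v _ => ?_
        rw [add_comm v u]; ring
    _ ≤ ∑ u ∈ S, w u ^ 2 * (2 * a + b * S.card) :=
        Finset.sum_le_sum fun u _ => mul_le_mul_of_nonneg_left (row u) (sq_nonneg _)
    _ = _ := by rw [← Finset.sum_mul, mul_comm]

lemma sum_sliceCorr_sq_le_of_kernel (f : HalfSlice n → ZMod 2) (S : Finset (Fin n → ZMod 2))
    (M : (Fin n → ZMod 2) → ℝ) {a b : ℝ} (ha : 0 ≤ a) (hb : 0 ≤ b)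
    (hM : ∀ u, |M u| ≤ if u = 0 ∨ u = 1 then a else b)
    (hphi : ∑ u ∈ S, ∑ v ∈ S, sliceCorr f u * sliceCorr f v * slicePhi (u + v) ≤
      ∑ u ∈ S, ∑ v ∈ S, sliceCorr f u * sliceCorr f v * M (u + v)) :
    ∑ u ∈ S, sliceCorr f u ^ 2 ≤ 2 * a + b * S.card := by
  have h := (sq_sum_sliceCorr_sq_le f S).trans
    (hphi.trans (sum_sum_mul_kernel_le S (sliceCorr f) M ha hb hM))
  have h0 : 0 ≤ ∑ u ∈ S, sliceCorr f u ^ 2 := Finset.sum_nonneg fun u _ => sq_nonneg _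
  rcases h0.eq_or_lt with h1 | h1
  · rw [← h1]; positivity
  · rw [sq] at h
    exact le_of_mul_le_mul_right h h1

lemma abs_slicePhi_one : |slicePhi (1 : Fin n → ZMod 2)| = 1 := by
  rw [← zero_add (1 : Fin n → ZMod 2), abs_slicePhi_add_one, slicePhi_zero, abs_one]

/-- The constant 2 is the multiplicity of the pair `u, u + 1`, whose characters agree up to sign on
`T`. It must match the limit 2 of the denominator. -/
lemma sum_sliceCorr_sq_le (hn : Even n) (h8 : 8 ≤ n) (f : HalfSlice n → ZMod 2)
    (S : Finset (Fin n → ZMod 2)) :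
    ∑ u ∈ S, sliceCorr f u ^ 2 ≤ 2 + 1 / ((n : ℝ) - 1) * S.card := by
  have hn8 : (8 : ℝ) ≤ n := by exact_mod_cast h8
  have hp1 : (0 : ℝ) < n - 1 := by linarith
  have := sum_sliceCorr_sq_le_of_kernel f S slicePhi (a := 1) (b := 1 / ((n : ℝ) - 1))
    (by norm_num) (by positivity) (fun u => ?_) le_rfl
  · linarith
  · split_ifs with h
    · rcases h with rfl | rfl
      · rw [slicePhi_zero, abs_one]
      · exact abs_slicePhi_one.le
    · push Not at h
      exact abs_slicePhi_le hn h8 u h.1 h.2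

/-- The constant is worse, but the error stays small for sets of size `o(n²)` rather than `o(n)`. -/
lemma sum_sliceCorr_sq_le_damped (hn : Even n) (h8 : 8 ≤ n) (f : HalfSlice n → ZMod 2)
    (S : Finset (Fin n → ZMod 2)) :
    ∑ u ∈ S, sliceCorr f u ^ 2 ≤ 4 + 3 / (((n : ℝ) - 1) * (n - 3)) * S.card := by
  have hn8 : (8 : ℝ) ≤ n := by exact_mod_cast h8
  have hp1 : (0 : ℝ) < n - 1 := by linarith
  have hp3 : (0 : ℝ) < n - 3 := by linarith
  have := sum_sliceCorr_sq_le_of_kernel f S dampedPhi (by norm_num) (by positivity)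
    (abs_dampedPhi_le hn h8) (sum_sum_mul_slicePhi_le_dampedPhi (by omega) S _)
  linarith

/-- Induction on the squared inequality; the step reduces to `16m(m+1) ≤ 4(2m+1)²`. -/
lemma four_pow_le_sqrt_mul_centralBinom {m : ℕ} (hm : 1 ≤ m) :
    (4 : ℝ) ^ m ≤ 2 * √m * m.centralBinom := by
  have key : (4 : ℝ) ^ m * 4 ^ m ≤ 4 * m * (m.centralBinom * m.centralBinom) := by
    induction m, hm using Nat.le_induction with
    | base => norm_num [Nat.centralBinom, Nat.choose]
    | succ m hm ih =>
      have h := Nat.succ_mul_centralBinom_succ m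
      have h' : ((m : ℝ) + 1) * (m + 1).centralBinom = 2 * (2 * m + 1) * m.centralBinom := by
        exact_mod_cast h
      have hm0 : (0 : ℝ) < m := by exact_mod_cast hm
      have h3 : (16 * m * (m + 1) : ℝ) ≤ 4 * (2 * m + 1) ^ 2 := by nlinarith
      have hC : (0 : ℝ) ≤ m.centralBinom * m.centralBinom := by positivity
      refine le_of_mul_le_mul_left ?_ (show (0 : ℝ) < m + 1 by positivity)
      calc ((m : ℝ) + 1) * (4 ^ (m + 1) * 4 ^ (m + 1))
          = 16 * (m + 1) * (4 ^ m * 4 ^ m) := by ring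
        _ ≤ 16 * (m + 1) * (4 * m * (m.centralBinom * m.centralBinom)) :=
            mul_le_mul_of_nonneg_left ih (by positivity)
        _ = 4 * ((16 * m * (m + 1)) * (m.centralBinom * m.centralBinom)) := by ring
        _ ≤ 4 * ((4 * (2 * m + 1) ^ 2) * (m.centralBinom * m.centralBinom)) := by gcongr
        _ = 4 * ((2 * (2 * m + 1) * m.centralBinom) * (2 * (2 * m + 1) * m.centralBinom)) := by
            ring
        _ = _ := by rw [← h']; push_cast; ring
  have hs : √(m : ℝ) * √m = m := Real.mul_self_sqrt (Nat.cast_nonneg m)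
  refine le_of_sq_le_sq (by nlinarith) (by positivity) 

lemma sum_sliceCorr_sq_univ_le (hn : Even n) (h2 : 2 ≤ n) (f : HalfSlice n → ZMod 2) :
    ∑ u, sliceCorr f u ^ 2 ≤ 2 * √n := by
  have hN := card_halfSlice_pos (n := n)
  rw [sum_sliceCorr_sq, div_le_iff₀ hN, card_halfSlice]
  obtain ⟨m, rfl⟩ := hn
  have h := four_pow_le_sqrt_mul_centralBinom (m := m) (by omega)
  rw [Nat.centralBinom] at h
  have h4 : (2 : ℝ) ^ (m + m) = 4 ^ m := by rw [← two_mul, pow_mul]; norm_num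
  rw [show (m + m) / 2 = m by omega, h4, Nat.cast_add]
  rw [two_mul m] at h
  have hs : √(m : ℝ) ≤ √((m : ℝ) + m) :=
    Real.sqrt_le_sqrt (by linarith [(Nat.cast_nonneg m : (0 : ℝ) ≤ m)])
  exact h.trans (mul_le_mul_of_nonneg_right (by linarith :
    2 * √(m : ℝ) ≤ 2 * √((m : ℝ) + m)) (Nat.cast_nonneg _))

end LargeSpectrum

/-! ### Three-level estimate and the two conclusions. -/

section Asymptotics

variable {n : ℕ}

lemma sum_sliceCorr_pow_le (hn : Even n) (h8 : 8 ≤ n) {t : ℝ} (ht : 4 ≤ t) (htn : t ^ 4 = n)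
    (f : HalfSlice n → ZMod 2) {k : ℕ} (hk : 3 ≤ k) {B : ℝ} (hB0 : 0 ≤ B) (hB1 : B ≤ 1)
    (hB : ∀ u, sliceCorr f u ^ k ≤ B * sliceCorr f u ^ 2) :
    ∑ u, sliceCorr f u ^ k ≤ 2 * B + 26 / t := by
  classical
  have ht0 : 0 < t := by linarith
  have hn8 : (8 : ℝ) ≤ n := by exact_mod_cast h8
  have hsqrt : √(n : ℝ) = t ^ 2 := by
    rw [← htn, show t ^ 4 = (t ^ 2) ^ 2 by ring, Real.sqrt_sq (by positivity)]
  set α := sliceCorr f with hα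
  have hα1 : ∀ u, |α u| ≤ 1 := abs_sliceCorr_le_one f
  set S := Finset.univ.filter fun u => 1 / t ^ 3 < |α u| with hS
  set R := Finset.univ.filter fun u => 1 / t < |α u| with hR
  have hRS : R ⊆ S := by
    intro u hu
    rw [hR, Finset.mem_filter] at hu
    rw [hS, Finset.mem_filter]
    refine ⟨hu.1, lt_of_le_of_lt ?_ hu.2⟩
    exact one_div_le_one_div_of_le ht0 (by nlinarith)
  have hcard : ∀ (c : ℝ) (Q : Finset (Fin n → ZMod 2)), 0 ≤ c → (∀ u ∈ Q, c ≤ |α u|) →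
      c ^ 2 * Q.card ≤ ∑ u ∈ Q, α u ^ 2 := by
    intro c Q hc hQ
    rw [mul_comm, ← nsmul_eq_mul]
    refine Finset.card_nsmul_le_sum _ _ _ fun u hu => ?_
    rw [← sq_abs (α u)]
    exact pow_le_pow_left₀ hc (hQ u hu) 2
  have hX := sum_sliceCorr_sq_le_damped hn h8 f S
  have hY := sum_sliceCorr_sq_le hn h8 f R
  have hXc := hcard (1 / t ^ 3) S (by positivity) fun u hu => (Finset.mem_filter.1 hu).2.le
  have hYc := hcard (1 / t) R (by positivity) fun u hu => (Finset.mem_filter.1 hu).2.le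
  have hYX : ∑ u ∈ R, α u ^ 2 ≤ ∑ u ∈ S, α u ^ 2 :=
    Finset.sum_le_sum_of_subset_of_nonneg hRS fun u _ _ => sq_nonneg _
  have hZ := sum_sliceCorr_sq_univ_le hn (by omega) f
  rw [hsqrt] at hZ
  rw [← hα] at hX hY hZ
  have hpt : ∀ u, α u ^ k ≤ B * (if u ∈ R then α u ^ 2 else 0) +
      1 / t * (if u ∈ S then α u ^ 2 else 0) + 1 / t ^ 3 * α u ^ 2 := by
    intro u
    have hs := sq_nonneg (α u)
    have h1 : α u ^ k ≤ |α u| * α u ^ 2 := by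
      calc α u ^ k ≤ |α u| ^ k := by rw [← abs_pow]; exact le_abs_self _
        _ ≤ |α u| ^ 3 := pow_le_pow_of_le_one (abs_nonneg _) (hα1 u) hk
        _ = |α u| * α u ^ 2 := by rw [← sq_abs (α u)]; ring
    have p1 : 0 ≤ 1 / t * α u ^ 2 := by positivity
    have p3 : 0 ≤ 1 / t ^ 3 * α u ^ 2 := by positivity
    by_cases hu : u ∈ R
    · rw [if_pos hu, if_pos (hRS hu)]
      linarith [hB u]
    · have hu' : |α u| ≤ 1 / t := by simpa [hR] using hu
      rw [if_neg hu, mul_zero, zero_add]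
      by_cases hu2 : u ∈ S
      · rw [if_pos hu2]
        linarith [mul_le_mul_of_nonneg_right hu' hs]
      · have hu3 : |α u| ≤ 1 / t ^ 3 := by simpa [hS] using hu2
        rw [if_neg hu2, mul_zero, zero_add]
        linarith [mul_le_mul_of_nonneg_right hu3 hs]
  have hsum := Finset.sum_le_sum fun u (_ : u ∈ (Finset.univ : Finset (Fin n → ZMod 2))) => hpt u
  rw [Finset.sum_add_distrib, Finset.sum_add_distrib, ← Finset.mul_sum, ← Finset.mul_sum,
    ← Finset.mul_sum, Finset.sum_ite_mem, Finset.sum_ite_mem, Finset.univ_inter,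
    Finset.univ_inter] at hsum
  set X := ∑ u ∈ S, α u ^ 2
  set Y := ∑ u ∈ R, α u ^ 2
  have hX0 : 0 ≤ X := Finset.sum_nonneg fun u _ => sq_nonneg _
  have hY0 : 0 ≤ Y := Finset.sum_nonneg fun u _ => sq_nonneg _
  have hSc : (S.card : ℝ) ≤ t ^ 6 * X := by
    have := mul_le_mul_of_nonneg_left hXc (show 0 ≤ t ^ 6 by positivity)
    rwa [← mul_assoc, show t ^ 6 * (1 / t ^ 3) ^ 2 = 1 by field_simp, one_mul] at this
  have hRc : (R.card : ℝ) ≤ t ^ 2 * Y := by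
    have := mul_le_mul_of_nonneg_left hYc (show 0 ≤ t ^ 2 by positivity)
    rwa [← mul_assoc, show t ^ 2 * (1 / t) ^ 2 = 1 by field_simp, one_mul] at this
  have hb3 : 3 / (((n : ℝ) - 1) * (n - 3)) ≤ 6 / t ^ 8 := by
    rw [show t ^ 8 = (n : ℝ) ^ 2 by rw [← htn]; ring,
      div_le_div_iff₀ (mul_pos (by linarith) (by linarith)) (by positivity)]
    nlinarith
  have hb1 : 1 / ((n : ℝ) - 1) ≤ 2 / t ^ 4 := by
    rw [htn, div_le_div_iff₀ (by linarith) (by positivity)]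
    linarith
  -- The size of `S` is bounded by `t^6 * X`, so the inequality becomes `X ≤ 4 + X/2`.
  have hX8 : X ≤ 8 := by
    have h1 : X ≤ 4 + 6 / t ^ 8 * (t ^ 6 * X) :=
      hX.trans (by gcongr)
    have h2 : 6 / t ^ 8 * (t ^ 6 * X) = 6 / t ^ 2 * X := by field_simp
    have h3 : 6 / t ^ 2 ≤ 1 / 2 := by
      rw [div_le_div_iff₀ (by positivity) (by norm_num)]; nlinarith
    have h4 := mul_le_mul_of_nonneg_right h3 hX0
    linarith
  -- Here `Y ≤ X ≤ 8` gives `|R| ≤ 8t²`, small enough against `n = t^4` for the sharp bound.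
  have hY2 : Y ≤ 2 + 16 / t := by
    have h1 : Y ≤ 2 + 2 / t ^ 4 * (t ^ 2 * 8) :=
      hY.trans (by gcongr; exact hRc.trans (by gcongr; linarith))
    have h2 : 2 / t ^ 4 * (t ^ 2 * 8) = 16 / t ^ 2 := by field_simp; norm_num
    have h3 : 16 / t ^ 2 ≤ 16 / t := by gcongr; nlinarith
    linarith
  have h1 : B * Y ≤ 2 * B + 16 / t := by
    have h : B * (16 / t) ≤ 1 * (16 / t) := mul_le_mul_of_nonneg_right hB1 (by positivity)
    linarith [mul_le_mul_of_nonneg_left hY2 hB0]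
  have h2 : 1 / t * X ≤ 8 / t := by
    rw [show 8 / t = 1 / t * 8 by ring]; gcongr
  have h3 : 1 / t ^ 3 * ∑ u, α u ^ 2 ≤ 2 / t := by
    calc 1 / t ^ 3 * ∑ u, α u ^ 2 ≤ 1 / t ^ 3 * (2 * t ^ 2) := by gcongr
      _ = 2 / t := by field_simp
  have : 26 / t = 16 / t + 8 / t + 2 / t := by ring
  linarith

lemma two_sub_le_sum_slicePhi_pow (hn : Even n) (h8 : 8 ≤ n) {t : ℝ} (ht : 4 ≤ t)
    (htn : t ^ 4 = n) {k : ℕ} (hk : 3 ≤ k) (hkn : Even k ∨ Even (n / 2)) :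
    2 - 4 / t ≤ ∑ u : Fin n → ZMod 2, slicePhi u ^ k := by
  have ht0 : 0 < t := by linarith
  have hn8 : (8 : ℝ) ≤ n := by exact_mod_cast h8
  have hsqrt : √(n : ℝ) = t ^ 2 := by
    rw [← htn, show t ^ 4 = (t ^ 2) ^ 2 by ring, Real.sqrt_sq (by positivity)]
  have hZ := sum_sliceCorr_sq_univ_le hn (by omega) (0 : HalfSlice n → ZMod 2)
  change ∑ u : Fin n → ZMod 2, slicePhi u ^ 2 ≤ _ at hZ
  rw [hsqrt] at hZ
  have h01 : (0 : Fin n → ZMod 2) ≠ 1 := fun h => by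
    have := congrFun h ⟨0, by omega⟩
    simp at this
  have hone : slicePhi (1 : Fin n → ZMod 2) ^ k = 1 := by
    rw [← zero_add (1 : Fin n → ZMod 2), slicePhi_add_one, slicePhi_zero, mul_one, ← pow_mul]
    exact Even.neg_one_pow (hkn.elim (fun h => h.mul_left _) fun h => h.mul_right _)
  have hpt : ∀ u : Fin n → ZMod 2, (if u = 0 then 1 else 0) + (if u = 1 then 1 else 0) -
      1 / ((n : ℝ) - 1) * slicePhi u ^ 2 ≤ slicePhi u ^ k := by
    intro u
    have hp : 0 ≤ 1 / ((n : ℝ) - 1) * slicePhi u ^ 2 :=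
      mul_nonneg (one_div_nonneg.2 (by linarith)) (sq_nonneg _)
    by_cases h0 : u = 0
    · subst h0
      rw [if_pos rfl, if_neg h01, slicePhi_zero, one_pow, one_pow]
      rw [slicePhi_zero, one_pow] at hp
      linarith
    by_cases h1 : u = 1
    · subst h1
      rw [if_neg h0, if_pos rfl, hone]
      linarith
    · rw [if_neg h0, if_neg h1]
      have hle := abs_slicePhi_le hn h8 u h0 h1
      have hk' : |slicePhi u ^ k| ≤ 1 / ((n : ℝ) - 1) * slicePhi u ^ 2 := by
        calc |slicePhi u ^ k| = |slicePhi u| ^ k := abs_pow _ _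
          _ ≤ |slicePhi u| ^ 3 :=
            pow_le_pow_of_le_one (abs_nonneg _) (abs_sliceCorr_le_one _ u) hk
          _ = |slicePhi u| * slicePhi u ^ 2 := by rw [← sq_abs (slicePhi u)]; ring
          _ ≤ _ := mul_le_mul_of_nonneg_right hle (sq_nonneg _)
      linarith [(abs_le.1 hk').1]
  have hsum := Finset.sum_le_sum fun u (_ : u ∈ (Finset.univ : Finset (Fin n → ZMod 2))) => hpt u
  rw [Finset.sum_sub_distrib, Finset.sum_add_distrib, Finset.sum_ite_eq', Finset.sum_ite_eq',
    if_pos (Finset.mem_univ _), if_pos (Finset.mem_univ _), ← Finset.mul_sum] at hsum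
  have hb1 : 1 / ((n : ℝ) - 1) ≤ 2 / t ^ 4 := by
    rw [htn, div_le_div_iff₀ (by linarith) (by positivity)]
    linarith
  have h2 : 1 / ((n : ℝ) - 1) * ∑ u : Fin n → ZMod 2, slicePhi u ^ 2 ≤
      2 / t ^ 4 * (2 * t ^ 2) :=
    mul_le_mul hb1 hZ (Finset.sum_nonneg fun u _ => sq_nonneg _) (by positivity)
  have h3 : 2 / t ^ 4 * (2 * t ^ 2) = 4 / t ^ 2 := by field_simp; norm_num
  have h4 : 4 / t ^ 2 ≤ 4 / t := by gcongr; nlinarith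
  linarith

/-- With `n ≥ 256` one has `t = n^(1/4) ≥ 4`, so the denominator is at least 1. The constant is `15
= (26 + 4)/2`. -/
lemma two_mul_blrPassProb_sub_one_le (hn : Even n) (h256 : 256 ≤ n)
    (f : HalfSlice n → ZMod 2) {k : ℕ} (hk : 3 ≤ k) (hkn : Even k ∨ Even (n / 2)) {B : ℝ}
    (hB0 : 0 ≤ B) (hB1 : B ≤ 1) (hB : ∀ u, sliceCorr f u ^ k ≤ B * sliceCorr f u ^ 2) :
    2 * blrPassProb k f - 1 ≤ B + 15 / √√(n : ℝ) := by
  have hn' : (256 : ℝ) ≤ n := by exact_mod_cast h256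
  have ht : 4 ≤ √√(n : ℝ) :=
    Real.le_sqrt_of_sq_le (Real.le_sqrt_of_sq_le (by norm_num; exact h256))
  have htn : √√(n : ℝ) ^ 4 = n := by
    rw [show (4 : ℕ) = 2 * 2 by norm_num, pow_mul, Real.sq_sqrt (Real.sqrt_nonneg _),
      Real.sq_sqrt (by linarith)]
  set t := √√(n : ℝ)
  have ht0 : 0 < t := by linarith
  have h1 := sum_sliceCorr_pow_le hn (by omega) ht htn f hk hB0 hB1 hB
  have h2 := two_sub_le_sum_slicePhi_pow hn (by omega) ht htn hk hkn
  change _ ≤ ∑ u, sliceCorr (0 : HalfSlice n → ZMod 2) u ^ k at h2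
  have h4 : 4 / t ≤ 1 := (div_le_one ht0).2 ht
  have h3 := blrPassProb_mul_sum f (by omega : 1 ≤ k) (by linarith)
  have hP : blrPassProb k f ≤ 1 := uniformProb_le_one _
  have ht15 : 15 / t = (26 / t + 4 / t) / 2 := by ring
  rcases le_total (2 * blrPassProb k f - 1) 0 with h0 | h0
  · have : 0 ≤ 15 / t := by positivity
    linarith
  · have h5 := mul_le_mul_of_nonneg_left h2 h0
    have h6 : (2 * blrPassProb k f - 1) * (4 / t) ≤ 1 * (4 / t) :=
      mul_le_mul_of_nonneg_right (by linarith) (by positivity)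
    rw [ht15]
    linarith

lemma tendsto_const_div_sqrt_sqrt (c : ℝ) :
    Tendsto (fun n : ℕ => c / √√(n : ℝ)) atTop (𝓝 0) :=
  ((Real.tendsto_sqrt_atTop.comp Real.tendsto_sqrt_atTop).comp
    tendsto_natCast_atTop_atTop).const_div_atTop c

lemma tendsto_ite_lt_const (N : ℕ) (c : ℝ) {g : ℕ → ℝ} (hg : Tendsto g atTop (𝓝 0)) :
    Tendsto (fun n => if n < N then c else g n) atTop (𝓝 0) := by
  refine hg.congr' ?_
  filter_upwards [eventually_ge_atTop N] with n hn
  rw [if_neg (not_lt.2 hn)]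

theorem exists_linearAgreement_ge :
    ∃ η : ℕ → ℝ, Tendsto η atTop (𝓝 0) ∧
      ∀ n : ℕ, 4 ∣ n → ∀ (f : HalfSlice n → ZMod 2) (δ : ℝ),
        blrPassProb 3 f = (1 + δ) / 2 →
          ∃ u : Fin n → ZMod 2, (1 + δ) / 2 - η n ≤ linearAgreement f u := by
  -- An error of 1 makes the claim trivial for `n < 256`.
  refine ⟨_, tendsto_ite_lt_const 256 1 (tendsto_const_div_sqrt_sqrt 15), ?_⟩
  intro n h4 f δ hδ
  have hP : blrPassProb 3 f ≤ 1 := uniformProb_le_one _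
  by_cases hlt : n < 256
  · refine ⟨0, ?_⟩
    have : 0 ≤ linearAgreement f 0 := uniformProb_nonneg _
    rw [if_pos hlt]
    linarith
  · rw [if_neg hlt]
    obtain ⟨u, hu⟩ := Finite.exists_max (sliceCorr f)
    obtain ⟨v, hv⟩ := exists_sliceCorr_nonneg (by omega) f
    refine ⟨u, ?_⟩
    have h := two_mul_blrPassProb_sub_one_le (by rw [even_iff_two_dvd]; omega) (by omega) f le_rfl
      (Or.inr (by rw [even_iff_two_dvd]; omega)) (hv.trans (hu v))
      (abs_le.1 (abs_sliceCorr_le_one f u)).2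
      -- For `k = 3` the exponent `k - 2` is 1, so the signed maximum serves as `B` and no constant
      -- `b` is needed.
      fun w => by rw [pow_succ']; exact mul_le_mul_of_nonneg_right (hu w) (sq_nonneg _)
    rw [linearAgreement_eq]
    have : 0 ≤ 15 / √√(n : ℝ) := by positivity
    linarith

/-- Take `B` to be the `(k-2)`-th power of the largest absolute correlation. Its root is extracted
by subadditivity of `x ↦ x^r` for `r ≤ 1`, and `b` absorbs the sign of the correlation. -/
theorem exists_affineAgreement_ge {k : ℕ} (hk : 3 ≤ k) :
    ∃ η : ℕ → ℝ, Tendsto η atTop (𝓝 0) ∧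
      ∀ n : ℕ, Even n → (Even k ∨ Even (n / 2)) →
        ∀ (f : HalfSlice n → ZMod 2) (δ : ℝ), 0 < δ →
          blrPassProb k f = (1 + δ) / 2 →
            ∃ (u : Fin n → ZMod 2) (b : ZMod 2),
              (1 + δ ^ (1 / ((k : ℝ) - 2))) / 2 - η n ≤ affineAgreement f u b := by
  have hkr : (1 : ℝ) ≤ ((k - 2 : ℕ) : ℝ) := by exact_mod_cast (by omega : 1 ≤ k - 2)
  have hcast : (k : ℝ) - 2 = ((k - 2 : ℕ) : ℝ) := by
    rw [Nat.cast_sub (by omega)]; norm_num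
  rw [hcast]
  set r : ℝ := 1 / ((k - 2 : ℕ) : ℝ) with hr
  have hr0 : 0 < r := by positivity
  have hr1 : r ≤ 1 := (div_le_one (by linarith)).2 hkr
  have hlim : Tendsto (fun n : ℕ => (15 / √√(n : ℝ)) ^ r) atTop (𝓝 0) := by
    simpa [Real.zero_rpow hr0.ne'] using
      (tendsto_const_div_sqrt_sqrt 15).rpow_const (p := r) (Or.inr hr0.le)
  refine ⟨_, tendsto_ite_lt_const 256 1 hlim, ?_⟩
  intro n hn hkn f δ hδ0 hδ
  have hP : blrPassProb k f ≤ 1 := uniformProb_le_one _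
  by_cases hlt : n < 256
  · refine ⟨0, 0, ?_⟩
    have : 0 ≤ affineAgreement f 0 0 := uniformProb_nonneg _
    have : δ ^ r ≤ 1 := Real.rpow_le_one hδ0.le (by linarith) hr0.le
    rw [if_pos hlt]
    linarith
  · rw [if_neg hlt]
    obtain ⟨u, hu⟩ := Finite.exists_max fun u => |sliceCorr f u|
    have hA0 := abs_nonneg (sliceCorr f u)
    have h := two_mul_blrPassProb_sub_one_le hn (by omega) f hk hkn (pow_nonneg hA0 (k - 2))
      (pow_le_one₀ hA0 (abs_sliceCorr_le_one f u)) fun w => by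
        calc sliceCorr f w ^ k ≤ |sliceCorr f w| ^ k := by
              rw [← abs_pow]; exact le_abs_self _
          _ = |sliceCorr f w| ^ (k - 2) * sliceCorr f w ^ 2 := by
              rw [← sq_abs (sliceCorr f w), ← pow_add, Nat.sub_add_cancel (by omega)]
          _ ≤ _ := mul_le_mul_of_nonneg_right
              (pow_le_pow_left₀ (abs_nonneg _) (hu w) _) (sq_nonneg _)
    have hε : 0 ≤ 15 / √√(n : ℝ) := by positivity
    have hroot : (|sliceCorr f u| ^ (k - 2)) ^ r = |sliceCorr f u| := by
      rw [hr, one_div, Real.pow_rpow_inv_natCast hA0 (by omega)]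
    have hδr : δ ^ r ≤ |sliceCorr f u| + (15 / √√(n : ℝ)) ^ r := by
      calc δ ^ r ≤ (|sliceCorr f u| ^ (k - 2) + 15 / √√(n : ℝ)) ^ r :=
            Real.rpow_le_rpow hδ0.le (by linarith) hr0.le
        _ ≤ (|sliceCorr f u| ^ (k - 2)) ^ r + (15 / √√(n : ℝ)) ^ r :=
            Real.rpow_add_le_add_rpow (pow_nonneg hA0 _) hε hr0.le hr1
        _ = _ := by rw [hroot]
    have hεr : 0 ≤ (15 / √√(n : ℝ)) ^ r := Real.rpow_nonneg hε r
    rcases le_total 0 (sliceCorr f u) with hs | hs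
    · refine ⟨u, 0, ?_⟩
      rw [affineAgreement_eq, signChar_zero, one_mul]
      rw [abs_of_nonneg hs] at hδr
      linarith
    · refine ⟨u, 1, ?_⟩
      rw [affineAgreement_eq, signChar_one]
      rw [abs_of_nonpos hs] at hδr
      linarith

end Asymptotics

theorem theorem1 :
    (∃ η : ℕ → ℝ, Tendsto η atTop (𝓝 0) ∧
      ∀ n : ℕ, 4 ∣ n → ∀ (f : HalfSlice n → ZMod 2) (δ : ℝ),
        blrPassProb 3 f = (1 + δ) / 2 →
          ∃ u : Fin n → ZMod 2, (1 + δ) / 2 - η n ≤ linearAgreement f u) ∧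
    (∀ k : ℕ, 3 ≤ k → ∃ η : ℕ → ℝ, Tendsto η atTop (𝓝 0) ∧
      ∀ n : ℕ, Even n → (Even k ∨ Even (n / 2)) →
        ∀ (f : HalfSlice n → ZMod 2) (δ : ℝ), 0 < δ →
          blrPassProb k f = (1 + δ) / 2 →
            ∃ (u : Fin n → ZMod 2) (b : ZMod 2),
              (1 + δ ^ (1 / ((k : ℝ) - 2))) / 2 - η n ≤ affineAgreement f u b) :=
  ⟨exists_linearAgreement_ge, fun _ hk => exists_affineAgreement_ge hk⟩
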